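/- Let $G$ be a finite directed graph without loops or multiple edges, let $\mathcal S=(S_v)_{v\in V(G)}$ be a family of nonempty sets of positive integers, and let $\mathcal A=V(G)$. The $\mathcal S$-graph shift $X(G,\mathcal S)\subseteq\mathcal A^{\mathbb Z}$ is the closure, in the product topology of the discrete topology on $\mathcal A$, of the set of all bi-infinite words $\cdots u_{-1}^{n_{-1}}u_0^{n_0}u_1^{n_1}\cdots$ with $u_i\in V(G)$, $n_i\in S_{u_i}$ and $(u_i,u_{i+1})\in E(G)$ for all $i\in\mathbb Z$. Assume that $X(G,\mathcal S)$ is nonempty (equivalently, $G$ contains a directed cycle). The generating matrix $B(x)$ is the $V(G)\times V(G)$ matrix whose $(i,j)$ entry is $\sum_{s\in S_i}x^s$ if $(i,j)\in E(G)$ and $0$ otherwise. For $x>0$, let $\rho(x)\in[0,\infty]$ be the spectral radius of $B(x)$ if all the series $\sum_{s\in S_v}x^s$, $v\in V(G)$, converge. If one of them diverges, let $\rho(x)=\sup_N\rho_N(x)$, where $\rho_N(x)$ is the spectral radius of the matrix with entries $\sum_{s\in S_i,\,s\le N}x^s$ if $(i,j)\in E(G)$ and $0$ otherwise. Then there is exactly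 one real number $\lambda>0$ with $\rho(\lambda)=1$, and the topological entropy of $X(G,\mathcal S)$ is $$h(X(G,\mathcal S))=\lim_{n\to\infty}\frac1n\log|\mathcal B_n(X(G,\mathcal S))|=\log\lambda^{-1},$$ where $\mathcal B_n(X)$ is the set of words of length $n$ that appear in some point of $X$; in particular this limit exists. -/

import Mathlib

open Filter Topology
open scoped ENNReal

/-- A set-equipped graph `(G, 𝒮)` on the vertex set `V`: a directed graph without loops (a relation
cannot have multiple edges), together with a nonempty set of positive integers at every vertex. -/
structure SetEquippedGraph (V : Type*) extends Digraph V where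
  loopless : ∀ v, ¬ Adj v v
  S : V → Set ℕ
  S_nonempty : ∀ v, (S v).Nonempty
  S_pos : ∀ v, ∀ s ∈ S v, 0 < s

namespace SetEquippedGraph

variable {V : Type*}

/-- The bi-infinite words `⋯ u₋₁^{n₋₁} u₀^{n₀} u₁^{n₁} ⋯` with `nᵢ ∈ S_{uᵢ}` and `(uᵢ, uᵢ₊₁)` an
edge for every `i : ℤ`. The integer `t i` is the position at which the block `uᵢ^{nᵢ}` starts;
since all `nᵢ` are positive, these blocks cover `ℤ`. -/
def blockWords (𝒢 : SetEquippedGraph V) : Set (ℤ → V) :=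
  {x | ∃ (u : ℤ → V) (n : ℤ → ℕ) (t : ℤ → ℤ),
    (∀ i, n i ∈ 𝒢.S (u i)) ∧ (∀ i, 𝒢.Adj (u i) (u (i + 1))) ∧
    (∀ i, t (i + 1) = t i + n i) ∧
    ∀ i k, t i ≤ k → k < t (i + 1) → x k = u i}

theorem blockWords_shift (𝒢 : SetEquippedGraph V) (g : ℤ) :
    Set.MapsTo (SymbolicDynamics.FullShift.shift g) 𝒢.blockWords 𝒢.blockWords := by
  rintro x ⟨u, n, t, hn, hu, ht, hx⟩
  refine ⟨u, n, fun i => t i - g, hn, hu, fun i => ?_, fun i k h1 h2 => ?_⟩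
  · simp only [ht i]; ring
  · exact hx i (g + k) (by dsimp only at h1; linarith) (by dsimp only at h2; linarith)

/-- The `𝒮`-graph shift `X(G, 𝒮)`: the closure of the set of block words in `V^ℤ`
(`V` carries the discrete topology where this is used). -/
def shiftSpace [TopologicalSpace V] (𝒢 : SetEquippedGraph V) :
    SymbolicDynamics.FullShift.Subshift V ℤ where
  carrier := closure 𝒢.blockWords
  isClosed := isClosed_closure
  mapsTo g := (𝒢.blockWords_shift g).closure (SymbolicDynamics.FullShift.continuous_shift g)

end SetEquippedGraph

/-- `𝓑_n(X)`: the words of length `n` that appear in some point of the shift space `X`. -/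
def allowedBlocks {A : Type*} [TopologicalSpace A]
    (X : SymbolicDynamics.FullShift.Subshift A ℤ) (n : ℕ) : Set (Fin n → A) :=
  {w | ∃ x ∈ X.carrier, ∃ m : ℤ, ∀ i : Fin n, w i = x (m + (i : ℕ))}

/-- The topological entropy `lim (1/n) log |𝓑_n(X)|` exists and equals `h`. -/
def HasEntropy {A : Type*} [TopologicalSpace A]
    (X : SymbolicDynamics.FullShift.Subshift A ℤ) (h : ℝ) : Prop :=
  Tendsto (fun n : ℕ => (1 / (n : ℝ)) * Real.log ((allowedBlocks X n).ncard : ℝ)) atTop (𝓝 h)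

/-- The generating function `∑_{s ∈ S} x^s` (used only where it converges). -/
noncomputable def genFun (S : Set ℕ) (x : ℝ) : ℝ := ∑' s : S, x ^ (s : ℕ)

open Classical in
/-- The generating matrix `B(x)` of the graph `G` with the sets `S`. -/
noncomputable def genMatrix {V : Type*} (G : Digraph V) (S : V → Set ℕ) (x : ℝ) : Matrix V V ℝ :=
  Matrix.of fun i j => if G.Adj i j then genFun (S i) x else 0

/-- The spectral radius of a real square matrix: the largest modulus of a complex eigenvalue. -/
noncomputable def matrixSpectralRadius {V : Type*} [Fintype V] [DecidableEq V]
    (M : Matrix V V ℝ) : ℝ≥0∞ :=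
  spectralRadius ℂ (M.map (fun r : ℝ => (r : ℂ)))

open Classical in
/-- The spectral radius `ρ(x)` of the generating matrix `B(x)`, for `x > 0`.
If all the series `∑_{s ∈ S_v} x^s` converge, it is the spectral radius of the real matrix `B(x)`.
Otherwise `B(x)` has infinite generating functions, and `ρ(x) ∈ [0, ∞]` is the (increasing) limit
of the spectral radii of the matrices obtained by truncating every `S_v` to `S_v ∩ [0, N]`. -/
noncomputable def SetEquippedGraph.rho {V : Type*} [Fintype V] [DecidableEq V]
    (𝒢 : SetEquippedGraph V) (x : ℝ) : ℝ≥0∞ :=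
  if ∀ v, Summable (fun s : 𝒢.S v => x ^ (s : ℕ)) then
    matrixSpectralRadius (genMatrix 𝒢.toDigraph 𝒢.S x)
  else
    ⨆ N : ℕ, matrixSpectralRadius (genMatrix 𝒢.toDigraph (fun v => 𝒢.S v ∩ Set.Iic N) x)

/-!
Let `N n = |𝓑_n(X)|`, `h = lim (1/n) log (N n)` and `r = e^{-h}`. Since `G` has no loops, a word has
at most one decomposition into blocks, so the entries of `B(x)^k` sum `x^{|w|}` over the words `w`
made of `k` blocks. Comparing `B(x)` with `P(x) = ∑ N n x^n` gives `ρ(r) = 1`: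

* For `x < r` the series `P(x)` converges, and it bounds the entries of all powers of the truncated
  matrices at the pairs of vertices through which block words extend to bi-infinite ones. The other
  vertices only matter for bounded powers, so `ρ_N(x) ≤ 1`; let `x` increase to `r`.
* `P(r) = ∞`, as `N n ≥ e^{hn}` by subadditivity. Every word of `X` has the form `i^p w j^q` with
  `w` made of complete blocks, so `P(r)` is at most a constant times `∑ B(r)^k` if `r < 1`, and this
  would converge if `ρ(r) < 1`. If `r = 1`, every entry of `B` along an infinite walk is at least
  `1`, so `ρ(1) ≥ 1`.

Finally `ρ(x) ≤ (x / y) ρ(y)` for `x ≤ y`, because all elements of the sets `S_v` are positive; this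
makes the solution of `ρ(λ) = 1` unique.
-/

section SpectralRadius

open Asymptotics
open scoped NNReal

section BanachAlgebra

variable {A : Type*} [NormedRing A] [NormedAlgebra ℂ A] [CompleteSpace A] {a : A} {c : ℝ≥0}

theorem isBigO_pow_of_spectralRadius_lt (h : spectralRadius ℂ a < c) :
    (fun k : ℕ => a ^ k) =O[atTop] fun k => (c : ℝ) ^ k := by
  refine IsBigO.of_bound 1 ?_
  filter_upwards [(spectrum.pow_nnnorm_pow_one_div_tendsto_nhds_spectralRadius
    a).eventually_lt_const h, eventually_ne_atTop 0] with k hk hk0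
  have hk' := pow_le_pow_left₀ zero_le hk.le k
  rw [one_div, ENNReal.rpow_inv_natCast_pow hk0] at hk'
  rw [Real.norm_of_nonneg (by positivity), one_mul]
  exact_mod_cast hk'

theorem isBigO_pow_of_lt_spectralRadius (h : c < spectralRadius ℂ a) :
    (fun k : ℕ => (c : ℝ) ^ k) =O[atTop] fun k => a ^ k := by
  refine IsBigO.of_bound 1 ?_
  filter_upwards [(spectrum.pow_nnnorm_pow_one_div_tendsto_nhds_spectralRadius
    a).eventually_const_lt h, eventually_ne_atTop 0] with k hk hk0
  have hk' := pow_le_pow_left₀ zero_le hk.le k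
  rw [one_div, ENNReal.rpow_inv_natCast_pow hk0] at hk'
  rw [Real.norm_of_nonneg (by positivity), one_mul]
  exact_mod_cast hk'

end BanachAlgebra

variable {V : Type*} [Fintype V]

open scoped Matrix.Norms.Operator in
theorem matrix_isBigO_iff {ι : Type*} {l : Filter ι} {f : ι → Matrix V V ℂ} {g : ι → ℝ} :
    f =O[l] g ↔ ∀ i j, (fun k => f k i j) =O[l] g := by
  constructor
  · refine fun h i j => (isBigO_of_le l fun k => ?_).trans h
    rw [← coe_nnnorm, ← coe_nnnorm, NNReal.coe_le_coe, Matrix.linfty_opNNNorm_def]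
    exact (Finset.single_le_sum (f := fun j => ‖f k i j‖₊) (fun _ _ => zero_le)
      (Finset.mem_univ j)).trans (Finset.le_sup (f := fun i => ∑ j, ‖f k i j‖₊) (Finset.mem_univ i))
  · intro h
    have hsum : (fun k => ∑ i, ∑ j, ‖f k i j‖) =O[l] g :=
      IsBigO.fun_sum fun i _ => IsBigO.fun_sum fun j _ => (h i j).norm_left
    refine (isBigO_of_le l fun k => ?_).trans hsum
    rw [Real.norm_of_nonneg (by positivity), Matrix.linfty_opNorm_def]
    have hle : Finset.univ.sup (fun i => ∑ j, ‖f k i j‖₊) ≤ ∑ i, ∑ j, ‖f k i j‖₊ :=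
      Finset.sup_le fun i hi =>
        Finset.single_le_sum (f := fun i => ∑ j, ‖f k i j‖₊) (fun _ _ => zero_le) hi
    simpa only [NNReal.coe_sum, coe_nnnorm] using NNReal.coe_le_coe.2 hle

variable [DecidableEq V] {M M' : Matrix V V ℝ}

open scoped Matrix.Norms.Operator in
theorem map_ofReal_pow_isBigO_iff {g : ℕ → ℝ} :
    (fun k : ℕ => M.map (fun r : ℝ => (r : ℂ)) ^ k) =O[atTop] g ↔
      ∀ i j, (fun k => (M ^ k) i j) =O[atTop] g := by
  have h (k : ℕ) : M.map (fun r : ℝ => (r : ℂ)) ^ k = (M ^ k).map (fun r : ℝ => (r : ℂ)) :=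
    (map_pow (Complex.ofRealHom.mapMatrix (m := V)) M k).symm
  simp only [h, matrix_isBigO_iff, Matrix.map_apply, Complex.isBigO_ofReal_left]

theorem isBigO_pow_apply_of_matrixSpectralRadius_lt {c : ℝ≥0} (h : matrixSpectralRadius M < c)
    (i j : V) : (fun k : ℕ => (M ^ k) i j) =O[atTop] fun k => (c : ℝ) ^ k := by
  open scoped Matrix.Norms.Operator in
  exact map_ofReal_pow_isBigO_iff.1 (isBigO_pow_of_spectralRadius_lt h) i j

theorem matrixSpectralRadius_le_of_isBigO {c : ℝ≥0}
    (h : ∀ i j, (fun k : ℕ => (M ^ k) i j) =O[atTop] fun k => (c : ℝ) ^ k) :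
    matrixSpectralRadius M ≤ c := by
  open scoped Matrix.Norms.Operator in
  by_contra! hlt
  obtain ⟨b, hcb, hb⟩ := ENNReal.lt_iff_exists_nnreal_btwn.1 hlt
  have hcb : (c : ℝ) < b := by exact_mod_cast hcb
  have hself := ((isBigO_pow_of_lt_spectralRadius hb).trans
    (map_ofReal_pow_isBigO_iff.2 h)).trans_isLittleO (isLittleO_pow_pow_of_lt_left c.2 hcb)
  exact isLittleO_irrefl (Frequently.of_forall fun k => (pow_pos (c.2.trans_lt hcb) k).ne') hself

theorem pow_apply_le_pow_apply {R : Type*} [Semiring R] [PartialOrder R]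
    [IsOrderedRing R] {A B : Matrix V V R} (hA : ∀ i j, 0 ≤ A i j) (hAB : ∀ i j, A i j ≤ B i j)
    (k : ℕ) (i j : V) : (A ^ k) i j ≤ (B ^ k) i j := by
  induction k generalizing j with
  | zero => rfl
  | succ k ih =>
    simp only [pow_succ, Matrix.mul_apply]
    exact Finset.sum_le_sum fun a _ => mul_le_mul (ih a) (hAB a j) (hA a j)
      ((Matrix.pow_apply_nonneg hA k i a).trans (ih a))

theorem matrixSpectralRadius_le_mul {c : ℝ} (hc : 0 < c) (hM : ∀ i j, 0 ≤ M i j)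
    (hMM' : ∀ i j, M i j ≤ c * M' i j) :
    matrixSpectralRadius M ≤ ENNReal.ofReal c * matrixSpectralRadius M' := by
  lift c to ℝ≥0 using hc.le
  rw [ENNReal.ofReal_coe_nnreal, ← ENNReal.div_le_iff' (by exact_mod_cast hc.ne') (by simp)]
  refine le_of_forall_gt_imp_ge_of_dense fun b hb => ?_
  rcases eq_or_ne b ∞ with rfl | hb'
  · exact le_top
  lift b to ℝ≥0 using hb'
  rw [ENNReal.div_le_iff' (by exact_mod_cast hc.ne') (by simp), ← ENNReal.coe_mul]
  refine matrixSpectralRadius_le_of_isBigO fun i j => ?_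
  have hpow (k : ℕ) : ‖(M ^ k) i j‖ ≤ ‖(c : ℝ) ^ k * (M' ^ k) i j‖ := by
    rw [Real.norm_of_nonneg (Matrix.pow_apply_nonneg hM k i j)]
    refine (pow_apply_le_pow_apply (B := (c : ℝ) • M') hM hMM' k i j).trans ?_
    rw [smul_pow, Matrix.smul_apply, smul_eq_mul]
    exact le_abs_self _
  simp only [NNReal.coe_mul, mul_pow]
  exact (isBigO_of_le _ hpow).trans
    ((isBigO_refl _ _).mul (isBigO_pow_apply_of_matrixSpectralRadius_lt hb i j))

theorem one_le_matrixSpectralRadius_of_walk {u : ℕ → V} (hM : ∀ i j, 0 ≤ M i j)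
    (hu : ∀ k, 1 ≤ M (u k) (u (k + 1))) : 1 ≤ matrixSpectralRadius M := by
  have hpow (k : ℕ) : 1 ≤ (M ^ k) (u 0) (u k) := by
    induction k with
    | zero => simp
    | succ k ih =>
      rw [pow_succ, Matrix.mul_apply]
      exact (one_le_mul_of_one_le_of_one_le ih (hu k)).trans (Finset.single_le_sum
        (f := fun a => (M ^ k) (u 0) a * M a (u (k + 1)))
        (fun a _ => mul_nonneg (Matrix.pow_apply_nonneg hM k _ a) (hM a _)) (Finset.mem_univ (u k)))
  by_contra! hlt
  obtain ⟨c, hc, hc1⟩ := ENNReal.lt_iff_exists_nnreal_btwn.1 hlt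
  have hbig : (fun k : ℕ => ∑ j, (M ^ k) (u 0) j) =O[atTop] fun k => (c : ℝ) ^ k :=
    IsBigO.fun_sum fun j _ => isBigO_pow_apply_of_matrixSpectralRadius_lt hc (u 0) j
  have hzero := hbig.trans_tendsto
    (tendsto_pow_atTop_nhds_zero_of_lt_one c.2 (by exact_mod_cast hc1))
  refine absurd (ge_of_tendsto' hzero fun k => (hpow k).trans ?_) (by norm_num)
  exact Finset.single_le_sum (f := fun j => (M ^ k) (u 0) j)
    (fun j _ => Matrix.pow_apply_nonneg hM k _ j) (Finset.mem_univ (u k))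

theorem ofReal_pow_apply (hM : ∀ i j, 0 ≤ M i j) (k : ℕ) (i j : V) :
    ENNReal.ofReal ((M ^ k) i j) = (M.map ENNReal.ofReal ^ k) i j := by
  induction k generalizing j with
  | zero => simp only [pow_zero, Matrix.one_apply]; split_ifs <;> simp
  | succ k ih =>
    have hterm (a : V) : 0 ≤ (M ^ k) i a * M a j :=
      mul_nonneg (Matrix.pow_apply_nonneg hM k i a) (hM a j)
    simp only [pow_succ, Matrix.mul_apply, ENNReal.ofReal_sum_of_nonneg fun a _ => hterm a,
      ENNReal.ofReal_mul (Matrix.pow_apply_nonneg hM k i _), ih, Matrix.map_apply]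

theorem tsum_ofReal_pow_apply_ne_top (h : matrixSpectralRadius M < 1) (i j : V) :
    ∑' k : ℕ, ENNReal.ofReal ((M ^ k) i j) ≠ ∞ := by
  obtain ⟨c, hc, hc1⟩ := ENNReal.lt_iff_exists_nnreal_btwn.1 h
  exact (summable_of_isBigO_nat (summable_geometric_of_lt_one c.2 (by exact_mod_cast hc1))
    (isBigO_pow_apply_of_matrixSpectralRadius_lt hc i j)).tsum_ofReal_ne_top

theorem eventually_pow_apply_eq_zero_of_acc {R : Type*} [Semiring R] {A : Matrix V V R}
    {r : V → V → Prop} (hA : ∀ i j, A i j ≠ 0 → r j i) {i : V} (hi : Acc r i) :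
    ∀ᶠ d : ℕ in atTop, ∀ j, (A ^ d) i j = 0 := by
  induction hi with
  | intro i _ ih =>
    have hnext : ∀ᶠ d : ℕ in atTop, ∀ a, A i a ≠ 0 → ∀ j, (A ^ d) a j = 0 :=
      eventually_all.2 fun a => eventually_imp_distrib_left.2 fun ha => ih a (hA i a ha)
    filter_upwards [(tendsto_sub_atTop_nat 1).eventually hnext, eventually_ge_atTop 1]
      with d hd hd1 j
    rw [← Nat.sub_add_cancel hd1, pow_succ', Matrix.mul_apply]
    refine Finset.sum_eq_zero fun a _ => ?_
    by_cases ha : A i a = 0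
    · rw [ha, zero_mul]
    · rw [hd a ha j, mul_zero]

theorem eventually_pow_apply_eq_zero_of_acc' {R : Type*} [CommSemiring R] {A : Matrix V V R}
    {r : V → V → Prop} (hA : ∀ i j, A i j ≠ 0 → r i j) {j : V} (hj : Acc r j) :
    ∀ᶠ d : ℕ in atTop, ∀ i, (A ^ d) i j = 0 := by
  simpa only [← Matrix.transpose_pow, Matrix.transpose_apply] using
    eventually_pow_apply_eq_zero_of_acc (A := A.transpose) (fun i j => hA j i) hj

theorem matrixSpectralRadius_le_one_of_pow_apply_le {r : V → V → Prop} {C : ℝ}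
    (hM : ∀ i j, 0 ≤ M i j) (hr : ∀ i j, M i j ≠ 0 → r i j)
    (hC : ∀ k i j, ¬ Acc r i → ¬ Acc (flip r) j → (M ^ k) i j ≤ C) :
    matrixSpectralRadius M ≤ 1 := by
  -- Long walks neither end at a vertex accessible for `r` nor start at one accessible for `flip r`,
  -- so `M ^ e * M ^ k * M ^ d` only involves the entries of `M ^ k` controlled by `hC`.
  obtain ⟨e, he⟩ : ∃ e, ∀ a, Acc r a → ∀ i, (M ^ e) i a = 0 :=
    (eventually_all.2 fun a => eventually_imp_distrib_left.2 fun ha =>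
      eventually_pow_apply_eq_zero_of_acc' hr ha).exists
  obtain ⟨d, hd⟩ : ∃ d, ∀ b, Acc (flip r) b → ∀ j, (M ^ d) b j = 0 :=
    (eventually_all.2 fun b => eventually_imp_distrib_left.2 fun hb =>
      eventually_pow_apply_eq_zero_of_acc (r := flip r) hr hb).exists
  have hbound (k : ℕ) (i j : V) :
      (M ^ (k + (e + d))) i j ≤ ∑ b, ∑ a, (M ^ e) i a * C * (M ^ d) b j := by
    rw [add_left_comm, ← add_assoc, pow_add, pow_add, Matrix.mul_apply]
    simp only [Matrix.mul_apply, Finset.sum_mul]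
    refine Finset.sum_le_sum fun b _ => Finset.sum_le_sum fun a _ => ?_
    by_cases ha : Acc r a
    · simp [he a ha]
    by_cases hb : Acc (flip r) b
    · simp [hd b hb]
    exact mul_le_mul_of_nonneg_right (mul_le_mul_of_nonneg_left (hC k a b ha hb)
      (Matrix.pow_apply_nonneg hM e i a)) (Matrix.pow_apply_nonneg hM d b j)
  refine matrixSpectralRadius_le_of_isBigO (c := 1) fun i j => IsBigO.of_bound
    (∑ b, ∑ a, (M ^ e) i a * C * (M ^ d) b j) ?_
  filter_upwards [eventually_ge_atTop (e + d)] with k hk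
  obtain ⟨k, rfl⟩ := Nat.exists_eq_add_of_le' hk
  rw [Real.norm_of_nonneg (Matrix.pow_apply_nonneg hM _ i j)]
  simpa using hbound k i j

end SpectralRadius

section Words

variable {A : Type*}

/-- The word `x m, x (m + 1), …, x (m + n - 1)` read off the bi-infinite sequence `x`. -/
def subword (x : ℤ → A) (m : ℤ) (n : ℕ) : List A :=
  List.ofFn fun p : Fin n => x (m + (p : ℕ))

@[simp]
theorem length_subword (x : ℤ → A) (m : ℤ) (n : ℕ) : (subword x m n).length = n :=
  List.length_ofFn

theorem subword_add (x : ℤ → A) (m : ℤ) (a b : ℕ) :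
    subword x m (a + b) = subword x m a ++ subword x (m + a) b := by
  simp [subword, List.ofFn_add, add_assoc]

theorem subword_eq_replicate {x : ℤ → A} {m : ℤ} {n : ℕ} {v : A}
    (h : ∀ k, m ≤ k → k < m + n → x k = v) : subword x m n = List.replicate n v := by
  rw [← List.ofFn_const]
  exact congrArg List.ofFn (funext fun p => h _ (by omega) (by omega))

theorem exists_map_add_one_eq_add {G : Type*} [AddCommGroup G] (d : ℤ → G) :
    ∃ t : ℤ → G, ∀ i, t (i + 1) = t i + d i := by
  refine ⟨fun i => ∑ k ∈ Finset.Ico 0 i, d k - ∑ k ∈ Finset.Ico i 0, d k, fun i => ?_⟩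
  beta_reduce
  rcases le_or_gt 0 i with hi | hi
  · rw [← Finset.insert_Ico_right_eq_Ico_add_one hi, Finset.sum_insert (by simp),
      Finset.Ico_eq_empty_of_le hi, Finset.Ico_eq_empty_of_le (show 0 ≤ i + 1 by omega)]
    simp [add_comm]
  · rw [← Finset.insert_Ico_add_one_left_eq_Ico hi, Finset.sum_insert (by simp),
      Finset.Ico_eq_empty_of_le hi.le,
      Finset.Ico_eq_empty_of_le (Int.add_one_le_iff.2 hi)]
    simp

theorem exists_le_lt_add_one {t : ℤ → ℤ} (ht : StrictMono t) (m : ℤ) :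
    ∃ a, t a ≤ m ∧ m < t (a + 1) := by
  obtain ⟨_, ⟨b, rfl⟩, hb⟩ := not_bddAbove_iff.1 ht.not_bddAbove_range_of_isSuccArchimedean m
  obtain ⟨_, ⟨a₀, rfl⟩, ha₀⟩ := not_bddBelow_iff.1 ht.not_bddBelow_range_of_isPredArchimedean m
  obtain ⟨a, ha, hmax⟩ := Int.exists_greatest_of_bdd (P := fun a => t a ≤ m)
    ⟨b, fun z hz => (ht.lt_iff_lt.1 (hz.trans_lt hb)).le⟩ ⟨a₀, ha₀.le⟩
  exact ⟨a, ha, not_le.1 fun h => absurd (hmax _ h) (by omega)⟩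

theorem exists_concat (u : ℤ → A) {n : ℤ → ℕ} (hn : ∀ i, 0 < n i) :
    ∃ (x : ℤ → A) (t : ℤ → ℤ), (∀ i, t (i + 1) = t i + n i) ∧
      ∀ i k, t i ≤ k → k < t (i + 1) → x k = u i := by
  obtain ⟨t, ht⟩ := exists_map_add_one_eq_add fun i => (n i : ℤ)
  have hmono : StrictMono t := strictMono_int_of_lt_succ fun i => by
    have := hn i
    rw [ht]
    omega
  choose a ha ha' using exists_le_lt_add_one hmono
  refine ⟨fun k => u (a k), t, ht, fun i k hik hki => congrArg u ?_⟩
  have := hmono.lt_iff_lt.1 ((ha k).trans_lt hki)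
  have := hmono.lt_iff_lt.1 (hik.trans_lt (ha' k))
  omega

theorem subword_eq_flatMap {x u : ℤ → A} {n : ℤ → ℕ} {t : ℤ → ℤ}
    (ht : ∀ i, t (i + 1) = t i + n i) (hx : ∀ i k, t i ≤ k → k < t (i + 1) → x k = u i)
    (a : ℤ) (k : ℕ) :
    ∃ N : ℕ, t (a + k) = t a + N ∧ subword x (t a) N =
      (List.range k).flatMap fun q => List.replicate (n (a + (q : ℕ))) (u (a + (q : ℕ))) := by
  induction k with
  | zero => exact ⟨0, by simp, by simp [subword]⟩
  | succ k ih =>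
    obtain ⟨N, hN, hw⟩ := ih
    refine ⟨N + n (a + k), by push_cast; rw [← add_assoc, ht, hN, add_assoc], ?_⟩
    rw [subword_add, hw, List.range_succ, List.flatMap_append, List.flatMap_singleton, ← hN,
      subword_eq_replicate fun p h1 h2 => hx (a + k) p h1 (by rwa [ht])]

theorem exists_int_chain {α : Type*} {r : α → α → Prop} {f g : ℕ → α}
    (hf : ∀ k, r (f k) (f (k + 1))) (hg : ∀ k, r (g (k + 1)) (g k)) (hgf : r (g 0) (f 0)) :
    ∃ u : ℤ → α, (∀ k : ℕ, u k = f k) ∧ ∀ i, r (u i) (u (i + 1)) := by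
  refine ⟨fun i => Int.casesOn i f g, fun _ => rfl, ?_⟩
  rintro (k | _ | k)
  exacts [hf k, hgf, hg k]

end Words

theorem replicate_append_inj_of_head?_ne {A : Type*} {a : A} {s t : ℕ} {w v : List A}
    (hw : w.head? ≠ some a) (hv : v.head? ≠ some a)
    (h : List.replicate s a ++ w = List.replicate t a ++ v) : s = t ∧ w = v := by
  induction s generalizing t with
  | zero =>
    cases t with
    | zero => exact ⟨rfl, by simpa using h⟩
    | succ t => exact absurd (by simpa [List.replicate_succ] using congrArg List.head? h) hw
  | succ s ih =>
    cases t with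
    | zero => exact absurd (by simpa [List.replicate_succ] using (congrArg List.head? h).symm) hv
    | succ t => exact (ih (by simpa [List.replicate_succ] using h)).imp_left (congrArg (· + 1))

/-- The words that appear in some point of `X`: the disjoint union over `n` of the sets `𝓑_n(X)`,
as a set of lists. -/
def language {A : Type*} [TopologicalSpace A] (X : SymbolicDynamics.FullShift.Subshift A ℤ) :
    Set (List A) :=
  {w | ∃ x ∈ X.carrier, ∃ m : ℤ, subword x m w.length = w}

theorem ofFn_mem_language_iff {A : Type*} [TopologicalSpace A]
    {X : SymbolicDynamics.FullShift.Subshift A ℤ} {n : ℕ} {w : Fin n → A} :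
    List.ofFn w ∈ language X ↔ w ∈ allowedBlocks X n := by
  simp only [language, allowedBlocks, Set.mem_ofPred_eq, List.length_ofFn, subword,
    List.ofFn_inj, funext_iff, Fin.val_cast, eq_comm]

theorem tsum_language {A : Type*} [Finite A] [TopologicalSpace A]
    (X : SymbolicDynamics.FullShift.Subshift A ℤ) (x : ℝ≥0∞) :
    ∑' w : language X, x ^ (w : List A).length =
      ∑' n : ℕ, ((allowedBlocks X n).ncard : ℝ≥0∞) * x ^ n := by
  rw [tsum_subtype (language X) fun w => x ^ w.length, ← List.equivSigmaTuple.symm.tsum_eq,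
    ENNReal.tsum_sigma']
  refine tsum_congr fun n => ?_
  have hindicator (w : Fin n → A) : (language X).indicator (fun w => x ^ w.length)
      (List.equivSigmaTuple.symm ⟨n, w⟩) = (allowedBlocks X n).indicator (fun _ => x ^ n) w := by
    classical simp [List.equivSigmaTuple, Set.indicator_apply, ofFn_mem_language_iff]
  simp only [hindicator]
  rw [← tsum_subtype, ENNReal.tsum_set_const, ← (Set.toFinite _).cast_ncard_eq, ENat.toENNReal_coe]

section Entropy

variable {A : Type*} [TopologicalSpace A] {X : SymbolicDynamics.FullShift.Subshift A ℤ}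

theorem allowedBlocks_nonempty (hX : X.carrier.Nonempty) (n : ℕ) : (allowedBlocks X n).Nonempty :=
  let ⟨x, hx⟩ := hX
  ⟨fun p => x (0 + (p : ℕ)), x, hx, 0, fun _ => rfl⟩

variable [Finite A]

theorem ncard_allowedBlocks_add_le (X : SymbolicDynamics.FullShift.Subshift A ℤ) (m n : ℕ) :
    (allowedBlocks X (m + n)).ncard ≤ (allowedBlocks X m).ncard * (allowedBlocks X n).ncard := by
  rw [← Set.ncard_prod]
  refine Set.ncard_le_ncard_of_injOn
    (fun w => (fun p => w (Fin.castAdd n p), fun p => w (Fin.natAdd m p))) ?_ ?_ (Set.toFinite _)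
  · rintro w ⟨x, hx, c, hw⟩
    exact ⟨⟨x, hx, c, fun p => hw _⟩, x, hx, c + m, fun p => by simp [hw, add_assoc]⟩
  · intro w _ v _ h
    obtain ⟨hl, hr⟩ := Prod.mk.inj h
    exact funext (Fin.addCases (congrFun hl) (congrFun hr))

theorem subadditive_log_ncard_allowedBlocks (hX : X.carrier.Nonempty) :
    Subadditive fun n => Real.log ((allowedBlocks X n).ncard : ℝ) := by
  have hpos (n : ℕ) : (0 : ℝ) < (allowedBlocks X n).ncard := by
    exact_mod_cast (Set.ncard_pos (Set.toFinite _)).2 (allowedBlocks_nonempty hX n)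
  intro m n
  rw [← Real.log_mul (hpos m).ne' (hpos n).ne']
  exact Real.log_le_log (hpos _) (by exact_mod_cast ncard_allowedBlocks_add_le X m n)

theorem exists_hasEntropy (hX : X.carrier.Nonempty) :
    ∃ h : ℝ, 0 ≤ h ∧ HasEntropy X h ∧
      ∀ n : ℕ, Real.exp h ^ n ≤ ((allowedBlocks X n).ncard : ℝ) := by
  have hsub := subadditive_log_ncard_allowedBlocks hX
  have hnonneg (n : ℕ) : 0 ≤ Real.log ((allowedBlocks X n).ncard : ℝ) / n :=
    div_nonneg (Real.log_natCast_nonneg _) n.cast_nonneg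
  have hbdd : BddBelow (Set.range fun n : ℕ => Real.log ((allowedBlocks X n).ncard : ℝ) / n) :=
    ⟨0, Set.forall_mem_range.2 hnonneg⟩
  have hlim := hsub.tendsto_lim hbdd
  refine ⟨hsub.lim, ge_of_tendsto' hlim hnonneg,
    by simpa only [HasEntropy, one_div_mul_eq_div] using hlim, fun n => ?_⟩
  have hpos : (0 : ℝ) < (allowedBlocks X n).ncard := by
    exact_mod_cast (Set.ncard_pos (Set.toFinite _)).2 (allowedBlocks_nonempty hX n)
  rcases eq_or_ne n 0 with rfl | hn
  · rw [pow_zero]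
    exact_mod_cast hpos
  · rw [← Real.exp_nat_mul, ← Real.le_log_iff_exp_le hpos, mul_comm]
    exact (le_div_iff₀ (by positivity)).1 (hsub.lim_le_div hbdd hn)

theorem tsum_language_ne_top {h x : ℝ} (hh : HasEntropy X h) (hx : 0 < x)
    (hxh : x < Real.exp (-h)) :
    ∑' w : language X, ENNReal.ofReal x ^ (w : List A).length ≠ ∞ := by
  obtain ⟨h', hhh', hh'x⟩ : ∃ h', h < h' ∧ h' < -Real.log x :=
    exists_between (by linarith [(Real.log_lt_iff_lt_exp hx).2 hxh])
  have hratio : Real.exp h' * x < 1 := by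
    rw [← Real.exp_log hx, ← Real.exp_add, Real.exp_lt_one_iff]
    linarith
  have hsummable : Summable fun n : ℕ => ((allowedBlocks X n).ncard : ℝ) * x ^ n := by
    refine summable_of_isBigO_nat (summable_geometric_of_lt_one (by positivity) hratio)
      (Asymptotics.IsBigO.of_bound 1 ?_)
    filter_upwards [hh.eventually_lt_const hhh', eventually_ne_atTop 0] with n hn hn0
    rw [one_div_mul_eq_div, div_lt_iff₀' (by positivity)] at hn
    have hcard : ((allowedBlocks X n).ncard : ℝ) ≤ Real.exp h' ^ n := by
      rw [← Real.exp_nat_mul]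
      exact Real.le_exp_of_log_le hn.le
    rw [Real.norm_of_nonneg (by positivity), Real.norm_of_nonneg (by positivity), one_mul, mul_pow]
    gcongr
  rw [tsum_language]
  convert hsummable.tsum_ofReal_ne_top using 3 with n
  rw [ENNReal.ofReal_mul (Nat.cast_nonneg _), ENNReal.ofReal_natCast, ENNReal.ofReal_pow hx.le]

theorem tsum_language_exp_neg_eq_top {h : ℝ}
    (hh : ∀ n : ℕ, Real.exp h ^ n ≤ ((allowedBlocks X n).ncard : ℝ)) :
    ∑' w : language X, ENNReal.ofReal (Real.exp (-h)) ^ (w : List A).length = ∞ := by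
  have hterm (n : ℕ) :
      1 ≤ ((allowedBlocks X n).ncard : ℝ≥0∞) * ENNReal.ofReal (Real.exp (-h)) ^ n := by
    rw [← ENNReal.ofReal_natCast, ← ENNReal.ofReal_pow (Real.exp_nonneg _),
      ← ENNReal.ofReal_mul (Nat.cast_nonneg _), ENNReal.one_le_ofReal]
    calc 1 = Real.exp h ^ n * Real.exp (-h) ^ n := by
          rw [← mul_pow, ← Real.exp_add, add_neg_cancel, Real.exp_zero, one_pow]
      _ ≤ _ := by gcongr; exact hh n
  rw [tsum_language, eq_top_iff, ← ENNReal.tsum_const_eq_top_of_ne_zero (α := ℕ) one_ne_zero]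
  exact ENNReal.tsum_le_tsum hterm

end Entropy

open Classical in
/-- The generating matrix `B(x)` with entries in `[0, ∞]`, where the generating functions need no
convergence assumption. -/
noncomputable def extGenMatrix {V : Type*} (G : Digraph V) (S : V → Set ℕ) (x : ℝ≥0∞) :
    Matrix V V ℝ≥0∞ :=
  Matrix.of fun i j => if G.Adj i j then ∑' s : S i, x ^ (s : ℕ) else 0

namespace SetEquippedGraph

variable {V : Type*} {𝒢 : SetEquippedGraph V} {k : ℕ} {i j : V} {w : List V}

/-- The words made of `k` complete blocks, the first at the vertex `i`, such that `j` is an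
admissible vertex of the block that follows (`j = i` if `k = 0`). -/
def blockPaths (𝒢 : SetEquippedGraph V) : ℕ → V → V → Set (List V)
  | 0, i, j => {w | w = [] ∧ i = j}
  | k + 1, i, j => {w | ∃ a, 𝒢.Adj i a ∧ ∃ s ∈ 𝒢.S i, ∃ v ∈ blockPaths 𝒢 k a j,
      w = List.replicate s i ++ v}

theorem head?_of_mem_blockPaths_succ (hw : w ∈ 𝒢.blockPaths (k + 1) i j) : w.head? = some i := by
  obtain ⟨a, -, s, hs, v, -, rfl⟩ := hw
  obtain ⟨s, rfl⟩ := Nat.exists_eq_succ_of_ne_zero (𝒢.S_pos i s hs).ne'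
  rfl

theorem head?_ne_of_mem_blockPaths {a : V} (ha : 𝒢.Adj i a) (hw : w ∈ 𝒢.blockPaths k a j) :
    w.head? ≠ some i := by
  cases k with
  | zero => simp [hw.1]
  | succ k =>
    rw [head?_of_mem_blockPaths_succ hw]
    rintro ⟨⟩
    exact 𝒢.loopless _ ha

theorem blockPaths_left_unique {i' : V} (h : w ∈ 𝒢.blockPaths k i j)
    (h' : w ∈ 𝒢.blockPaths k i' j) : i = i' := by
  cases k with
  | zero => exact h.2.trans h'.2.symm
  | succ k =>
    exact Option.some.inj
      ((head?_of_mem_blockPaths_succ h).symm.trans (head?_of_mem_blockPaths_succ h'))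

/-- Prepending a block at the vertex `i`. Since `G` has no loops, the block can be recovered from
the word, which is what makes the powers of the generating matrix count words. -/
def consBlock (𝒢 : SetEquippedGraph V) (k : ℕ) (i j : V)
    (p : Σ a : {a | 𝒢.Adj i a}, 𝒢.S i × 𝒢.blockPaths k a j) : 𝒢.blockPaths (k + 1) i j :=
  ⟨List.replicate (p.2.1 : ℕ) i ++ (p.2.2 : List V),
    p.1, p.1.2, p.2.1, p.2.1.2, p.2.2, p.2.2.2, rfl⟩

theorem consBlock_bijective (𝒢 : SetEquippedGraph V) (k : ℕ) (i j : V) :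
    Function.Bijective (𝒢.consBlock k i j) := by
  constructor
  · rintro ⟨⟨a, ha⟩, ⟨s, hs⟩, ⟨w, hw⟩⟩ ⟨⟨a', ha'⟩, ⟨s', hs'⟩, ⟨w', hw'⟩⟩ h
    obtain ⟨rfl, rfl⟩ := replicate_append_inj_of_head?_ne (head?_ne_of_mem_blockPaths ha hw)
      (head?_ne_of_mem_blockPaths ha' hw') (congrArg Subtype.val h)
    obtain rfl := blockPaths_left_unique hw hw'
    rfl
  · rintro ⟨_, a, ha, s, hs, w, hw, rfl⟩
    exact ⟨⟨⟨a, ha⟩, ⟨s, hs⟩, ⟨w, hw⟩⟩, rfl⟩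

theorem extGenMatrix_pow_apply [Fintype V] [DecidableEq V] (𝒢 : SetEquippedGraph V) (x : ℝ≥0∞)
    (k : ℕ) (i j : V) :
    (extGenMatrix 𝒢.toDigraph 𝒢.S x ^ k) i j =
      ∑' w : 𝒢.blockPaths k i j, x ^ (w : List V).length := by
  induction k generalizing i j with
  | zero =>
    by_cases h : i = j
    · have hone : 𝒢.blockPaths 0 i j = {[]} := by ext w; simp [blockPaths, h]
      rw [hone, tsum_singleton [] fun w : List V => x ^ w.length]
      simp [h]
    · have hempty : 𝒢.blockPaths 0 i j = ∅ := by ext w; simp [blockPaths, h]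
      simp [hempty, h]
  | succ k ih =>
    let B := extGenMatrix 𝒢.toDigraph 𝒢.S x
    have hblock (a : V) : B i a * (B ^ k) a j = Set.indicator {a | 𝒢.Adj i a}
        (fun a => ∑' p : 𝒢.S i × 𝒢.blockPaths k a j,
          x ^ (p.1 : ℕ) * x ^ (p.2 : List V).length) a := by
      by_cases ha : 𝒢.Adj i a
      · rw [Set.indicator_of_mem (by exact ha), ENNReal.tsum_prod']
        have hentry : B i a = ∑' s : 𝒢.S i, x ^ (s : ℕ) := if_pos ha
        simp only [hentry, B, ih, ENNReal.tsum_mul_left, ENNReal.tsum_mul_right]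
      · rw [Set.indicator_of_notMem (by exact ha)]
        simp [B, extGenMatrix, ha]
    calc (B ^ (k + 1)) i j
        = ∑' a : {a | 𝒢.Adj i a}, ∑' p : 𝒢.S i × 𝒢.blockPaths k a j,
            x ^ (p.1 : ℕ) * x ^ (p.2 : List V).length := by
          rw [pow_succ', Matrix.mul_apply, Finset.sum_congr rfl fun a _ => hblock a,
            tsum_subtype {a | 𝒢.Adj i a} fun a => ∑' p : 𝒢.S i × 𝒢.blockPaths k a j,
              x ^ (p.1 : ℕ) * x ^ (p.2 : List V).length, tsum_fintype]
      _ = ∑' p, x ^ (𝒢.consBlock k i j p : List V).length := by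
          simp [ENNReal.tsum_sigma', consBlock, pow_add]
      _ = ∑' w : 𝒢.blockPaths (k + 1) i j, x ^ (w : List V).length :=
          (Equiv.ofBijective _ (𝒢.consBlock_bijective k i j)).tsum_eq
            fun w : 𝒢.blockPaths (k + 1) i j => x ^ (w : List V).length

theorem flatMap_replicate_mem_blockPaths {u : ℕ → V} {n : ℕ → ℕ} (hn : ∀ q, n q ∈ 𝒢.S (u q))
    (hu : ∀ q, 𝒢.Adj (u q) (u (q + 1))) (k : ℕ) :
    (List.range k).flatMap (fun q => List.replicate (n q) (u q)) ∈ 𝒢.blockPaths k (u 0) (u k) := by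
  induction k generalizing u n with
  | zero => exact ⟨rfl, rfl⟩
  | succ k ih =>
    refine ⟨u 1, hu 0, n 0, hn 0, _, ih (fun q => hn (q + 1)) fun q => hu (q + 1), ?_⟩
    rw [List.range_succ_eq_map, List.flatMap_cons, List.flatMap_map]

theorem exists_flatMap_replicate_of_mem_blockPaths (hw : w ∈ 𝒢.blockPaths k i j) {f : ℕ → V}
    (hf0 : f 0 = j) (hf : ∀ q, 𝒢.Adj (f q) (f (q + 1))) :
    ∃ (u : ℕ → V) (n : ℕ → ℕ), u 0 = i ∧ (∀ q, n q ∈ 𝒢.S (u q)) ∧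
      (∀ q, 𝒢.Adj (u q) (u (q + 1))) ∧
      w = (List.range k).flatMap fun q => List.replicate (n q) (u q) := by
  induction k generalizing i w with
  | zero =>
    obtain ⟨rfl, rfl⟩ := hw
    choose s hs using 𝒢.S_nonempty
    exact ⟨f, fun q => s (f q), hf0, fun q => hs (f q), hf, rfl⟩
  | succ k ih =>
    obtain ⟨_, ha, s, hs, v, hv, rfl⟩ := hw
    obtain ⟨u, n, rfl, hn, hu, rfl⟩ := ih hv
    refine ⟨fun q => Nat.casesOn q i u, fun q => Nat.casesOn q s n, rfl,
      fun q => Nat.casesOn q hs hn, fun q => Nat.casesOn q ha hu, ?_⟩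
    rw [List.range_succ_eq_map, List.flatMap_cons, List.flatMap_map]
    rfl

variable [TopologicalSpace V] [DiscreteTopology V]

theorem mem_language_shiftSpace_iff :
    w ∈ language 𝒢.shiftSpace ↔ ∃ x ∈ 𝒢.blockWords, ∃ m, subword x m w.length = w := by
  refine ⟨?_, fun ⟨x, hx, m, hw⟩ => ⟨x, subset_closure hx, m, hw⟩⟩
  rintro ⟨x, hx, m, hw⟩
  have hopen : IsOpen (⋂ p : Fin w.length, (fun y : ℤ → V => y (m + (p : ℕ))) ⁻¹'
      {x (m + (p : ℕ))}) :=
    isOpen_iInter_of_finite fun p => (isOpen_discrete _).preimage (continuous_apply _)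
  obtain ⟨y, hy, hyB⟩ := mem_closure_iff.1 hx _ hopen (Set.mem_iInter.2 fun p => rfl)
  refine ⟨y, hyB, m, hw ▸ ?_⟩
  rw [length_subword]
  exact congrArg List.ofFn (funext fun p => Set.mem_iInter.1 hy p)

theorem blockPaths_subset_language (hi : ¬ Acc 𝒢.Adj i) (hj : ¬ Acc (flip 𝒢.Adj) j) :
    𝒢.blockPaths k i j ⊆ language 𝒢.shiftSpace := by
  intro w hw
  obtain ⟨f, hf0, hf⟩ := not_acc_iff_exists_descending_chain.1 hj
  obtain ⟨g, rfl, hg⟩ := not_acc_iff_exists_descending_chain.1 hi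
  obtain ⟨u, n, hu0, hn, hu, rfl⟩ := exists_flatMap_replicate_of_mem_blockPaths hw hf0 hf
  choose s hs using 𝒢.S_nonempty
  obtain ⟨b, hbu, hb⟩ := exists_int_chain
    (r := fun b c : V × ℕ => b.2 ∈ 𝒢.S b.1 ∧ 𝒢.Adj b.1 c.1)
    (f := fun q => (u q, n q)) (g := fun q => (g (q + 1), s (g (q + 1))))
    (fun q => ⟨hn q, hu q⟩) (fun q => ⟨hs _, hg (q + 1)⟩) ⟨hs _, hu0 ▸ hg 0⟩
  obtain ⟨x, t, ht, hx⟩ := exists_concat (fun q => (b q).1) (n := fun q => (b q).2)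
    fun q => 𝒢.S_pos _ _ (hb q).1
  obtain ⟨N, -, hN⟩ := subword_eq_flatMap ht hx 0 k
  simp only [zero_add, hbu] at hN
  exact mem_language_shiftSpace_iff.2
    ⟨x, ⟨_, _, t, fun q => (hb q).1, fun q => (hb q).2, ht, hx⟩, t 0, by rw [← hN, length_subword]⟩

theorem exists_eq_replicate_append_of_mem_language (hw : w ∈ language 𝒢.shiftSpace) :
    ∃ p i q j k i' j', ∃ v ∈ 𝒢.blockPaths k i' j',
      w = List.replicate p i ++ (v ++ List.replicate q j) := by
  obtain ⟨x, ⟨u, n, t, hn, hu, ht, hx⟩, m, hw⟩ := mem_language_shiftSpace_iff.1 hw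
  generalize w.length = l at hw
  subst hw
  have hmono : StrictMono t := strictMono_int_of_lt_succ fun i => by
    have := 𝒢.S_pos _ _ (hn i)
    rw [ht]
    omega
  obtain ⟨a, ha, ha'⟩ := exists_le_lt_add_one hmono m
  obtain ⟨b, hb, hb'⟩ := exists_le_lt_add_one hmono (m + l)
  have hab : a < b + 1 := hmono.lt_iff_lt.1 (by omega)
  rcases (Int.lt_add_one_iff.1 hab).eq_or_lt with rfl | hab
  · refine ⟨l, u a, 0, u a, 0, u a, u a, [], ⟨rfl, rfl⟩, ?_⟩
    rw [subword_eq_replicate fun k h1 h2 => hx a k (by omega) (by omega)]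
    simp
  · obtain ⟨k, rfl⟩ := Int.le.dest (Int.add_one_le_iff.2 hab)
    obtain ⟨N, hN, hv⟩ := subword_eq_flatMap ht hx (a + 1) k
    obtain ⟨p, hp⟩ := Int.le.dest ha'.le
    obtain ⟨q, hq⟩ := Int.le.dest hb
    obtain rfl : l = p + (N + q) := by omega
    refine ⟨p, u a, q, u (a + 1 + k), k, _, _, _, flatMap_replicate_mem_blockPaths
      (u := fun q => u (a + 1 + (q : ℕ))) (fun q => hn _) (fun q => ?_) k, ?_⟩
    · push_cast
      rw [← add_assoc]
      exact hu _
    · rw [subword_add, subword_add, hp, hv, ← hN,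
        subword_eq_replicate fun k h1 h2 => hx a k (by omega) (by omega),
        subword_eq_replicate fun k h1 h2 => hx _ k h1 (by omega)]

variable [Fintype V] [DecidableEq V]

theorem extGenMatrix_pow_apply_le_tsum_language (x : ℝ≥0∞) (k : ℕ) (hi : ¬ Acc 𝒢.Adj i)
    (hj : ¬ Acc (flip 𝒢.Adj) j) :
    (extGenMatrix 𝒢.toDigraph 𝒢.S x ^ k) i j ≤
      ∑' w : language 𝒢.shiftSpace, x ^ (w : List V).length := by
  rw [extGenMatrix_pow_apply]
  exact ENNReal.tsum_mono_subtype (fun w : List V => x ^ w.length)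
    (blockPaths_subset_language hi hj)

theorem tsum_language_le (x : ℝ≥0∞) :
    ∑' w : language 𝒢.shiftSpace, x ^ (w : List V).length ≤
      (Fintype.card V * (1 - x)⁻¹) ^ 2 *
        ∑ i, ∑ j, ∑' k : ℕ, (extGenMatrix 𝒢.toDigraph 𝒢.S x ^ k) i j := by
  let P : Set (List V) := ⋃ c : V × V × ℕ, 𝒢.blockPaths c.2.2 c.1 c.2.1
  have hparse : ∀ w : language 𝒢.shiftSpace, ∃ c : (ℕ × V) × (ℕ × V) × P, (w : List V) =
      List.replicate c.1.1 c.1.2 ++ ((c.2.2 : List V) ++ List.replicate c.2.1.1 c.2.1.2) := by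
    rintro ⟨w, hw⟩
    obtain ⟨p, i, q, j, k, i', j', v, hv, h⟩ := exists_eq_replicate_append_of_mem_language hw
    exact ⟨((p, i), (q, j), ⟨v, Set.mem_iUnion.2 ⟨(i', j', k), hv⟩⟩), h⟩
  choose parse hparse using hparse
  have hinj : Function.Injective parse := fun w v h =>
    Subtype.ext (by rw [hparse w, hparse v, h])
  calc ∑' w : language 𝒢.shiftSpace, x ^ (w : List V).length
      = ∑' w, x ^ (parse w).1.1 * (x ^ (parse w).2.1.1 * x ^ ((parse w).2.2 : List V).length) :=
        tsum_congr fun w => by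
          rw [hparse w]
          simp only [List.length_append, List.length_replicate, pow_add]
          ring
    _ ≤ ∑' c : (ℕ × V) × (ℕ × V) × P,
          x ^ c.1.1 * (x ^ c.2.1.1 * x ^ (c.2.2 : List V).length) :=
        ENNReal.tsum_comp_le_tsum_of_injective hinj fun c : (ℕ × V) × (ℕ × V) × P =>
          x ^ c.1.1 * (x ^ c.2.1.1 * x ^ (c.2.2 : List V).length)
    _ = (Fintype.card V * (1 - x)⁻¹) ^ 2 * ∑' w : P, x ^ (w : List V).length := by
        simp only [ENNReal.tsum_prod', ENNReal.tsum_mul_left, ENNReal.tsum_mul_right, tsum_fintype,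
          Finset.sum_const, Finset.card_univ, nsmul_eq_mul, ENNReal.tsum_geometric]
        ring
    _ ≤ _ := by
        gcongr
        refine (ENNReal.tsum_iUnion_le_tsum (fun w : List V => x ^ w.length) _).trans_eq ?_
        simp only [ENNReal.tsum_prod', tsum_fintype, extGenMatrix_pow_apply]

end SetEquippedGraph

section GenFun

variable {S : Set ℕ} {x y : ℝ}

theorem genFun_nonneg (hx : 0 ≤ x) : 0 ≤ genFun S x :=
  tsum_nonneg fun _ => pow_nonneg hx _

theorem ofReal_genFun (hx : 0 ≤ x) (hS : Summable fun s : S => x ^ (s : ℕ)) :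
    ENNReal.ofReal (genFun S x) = ∑' s : S, ENNReal.ofReal x ^ (s : ℕ) := by
  rw [genFun, ENNReal.ofReal_tsum_of_nonneg (fun _ => pow_nonneg hx _) hS]
  simp only [ENNReal.ofReal_pow hx]

theorem genFun_pos (hS : S.Nonempty) (hx : 0 < x) (hs : Summable fun s : S => x ^ (s : ℕ)) :
    0 < genFun S x :=
  let ⟨s, hsS⟩ := hS
  hs.tsum_pos (fun _ => pow_nonneg hx.le _) ⟨s, hsS⟩ (pow_pos hx _)

theorem pow_le_genFun {s : ℕ} (hs : s ∈ S) (hx : 0 ≤ x)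
    (hS : Summable fun s : S => x ^ (s : ℕ)) : x ^ s ≤ genFun S x :=
  hS.le_tsum ⟨s, hs⟩ fun _ _ => pow_nonneg hx _

theorem summable_pow_subtype_of_lt_one (S : Set ℕ) (hx : 0 ≤ x) (hx1 : x < 1) :
    Summable fun s : S => x ^ (s : ℕ) :=
  (summable_geometric_of_lt_one hx hx1).subtype S

theorem genFun_mono_set {T : Set ℕ} (hx : 0 ≤ x) (hTS : T ⊆ S)
    (hS : Summable fun s : S => x ^ (s : ℕ)) : genFun T x ≤ genFun S x :=
  (hS.comp_injective (Set.inclusion_injective hTS)).tsum_le_tsum_of_inj (Set.inclusion hTS)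
    (Set.inclusion_injective hTS) (fun _ _ => pow_nonneg hx _) (fun _ => le_rfl) hS

theorem genFun_le_div_mul (hS : ∀ s ∈ S, 0 < s) (hx : 0 ≤ x) (hxy : x ≤ y) (hy : 0 < y)
    (hSy : Summable fun s : S => y ^ (s : ℕ)) : genFun S x ≤ x / y * genFun S y := by
  have hle (s : S) : x ^ (s : ℕ) ≤ x / y * y ^ (s : ℕ) := by
    rw [← div_le_iff₀ (by positivity), ← div_pow]
    exact pow_le_of_le_one (by positivity) ((div_le_one hy).2 hxy) (hS s s.2).ne'
  rw [genFun, genFun, ← tsum_mul_left]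
  exact Summable.tsum_le_tsum hle
    (Summable.of_nonneg_of_le (fun _ => pow_nonneg hx _) hle (hSy.mul_left _)) (hSy.mul_left _)

theorem summable_pow_inter_Iic (S : Set ℕ) (N : ℕ) (x : ℝ) :
    Summable fun s : ↥(S ∩ Set.Iic N) => x ^ (s : ℕ) :=
  .of_finite

theorem genFun_inter_Iic_le_pow_mul {N : ℕ} (hx : 0 < x) (hxy : x ≤ y) :
    genFun (S ∩ Set.Iic N) y ≤ (y / x) ^ N * genFun (S ∩ Set.Iic N) x := by
  rw [genFun, genFun, ← tsum_mul_left]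
  refine Summable.tsum_le_tsum (fun s => ?_) (summable_pow_inter_Iic S N y)
    ((summable_pow_inter_Iic S N x).mul_left _)
  rw [← div_le_iff₀ (by positivity), ← div_pow]
  exact pow_le_pow_right₀ ((one_le_div hx).2 hxy) s.2.2

theorem tendsto_genFun_inter_Iic (hS : Summable fun s : S => x ^ (s : ℕ)) :
    Tendsto (fun N => genFun (S ∩ Set.Iic N) x) atTop (𝓝 (genFun S x)) := by
  have htrunc (N : ℕ) :
      genFun (S ∩ Set.Iic N) x = ∑ s ∈ Finset.range (N + 1), S.indicator (x ^ ·) s := by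
    rw [Nat.range_succ_eq_Iic, ← Finset.tsum_subtype', Finset.coe_Iic,
      tsum_subtype (Set.Iic N) (S.indicator (x ^ ·)), Set.indicator_indicator, Set.inter_comm _ S]
    exact tsum_subtype (S ∩ Set.Iic N) (x ^ ·)
  simp only [htrunc]
  exact ((hasSum_subtype_iff_indicator.1 hS.hasSum).tendsto_sum_nat).comp (tendsto_add_atTop_nat 1)

end GenFun

section GenMatrix

variable {V : Type*} {G : Digraph V} {S T : V → Set ℕ} {x y c : ℝ}

theorem genMatrix_nonneg (G : Digraph V) (S : V → Set ℕ) (hx : 0 ≤ x) (i j : V) :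
    0 ≤ genMatrix G S x i j := by
  simp only [genMatrix, Matrix.of_apply]
  split_ifs
  exacts [genFun_nonneg hx, le_rfl]

theorem adj_of_genMatrix_ne_zero {i j : V} (h : genMatrix G S x i j ≠ 0) : G.Adj i j := by
  by_contra hij
  exact h (if_neg hij)

theorem genMatrix_le_mul (h : ∀ v, genFun (S v) x ≤ c * genFun (T v) y) (i j : V) :
    genMatrix G S x i j ≤ c * genMatrix G T y i j := by
  simp only [genMatrix, Matrix.of_apply, mul_ite, mul_zero]
  split_ifs
  exacts [h i, le_rfl]

theorem map_ofReal_genMatrix (hx : 0 ≤ x) (hS : ∀ v, Summable fun s : S v => x ^ (s : ℕ)) :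
    (genMatrix G S x).map ENNReal.ofReal = extGenMatrix G S (ENNReal.ofReal x) := by
  ext i j
  simp only [genMatrix, extGenMatrix, Matrix.map_apply, Matrix.of_apply, apply_ite ENNReal.ofReal,
    ofReal_genFun hx (hS i), ENNReal.ofReal_zero]

theorem extGenMatrix_mono (hST : ∀ v, S v ⊆ T v) (x : ℝ≥0∞) (i j : V) :
    extGenMatrix G S x i j ≤ extGenMatrix G T x i j := by
  simp only [extGenMatrix, Matrix.of_apply]
  split_ifs
  exacts [ENNReal.tsum_mono_subtype (x ^ ·) (hST i), le_rfl]

end GenMatrix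

theorem le_of_tendsto_one_of_le_ofReal_mul {ι : Type*} {l : Filter ι} [l.NeBot] {c : ι → ℝ}
    {a b : ℝ≥0∞} (hc : Tendsto c l (𝓝 1)) (h : ∀ᶠ i in l, a ≤ ENNReal.ofReal (c i) * b) :
    a ≤ b := by
  have hlim := ENNReal.Tendsto.mul_const (b := b) (ENNReal.tendsto_ofReal hc) (Or.inl (by simp))
  rw [ENNReal.ofReal_one, one_mul] at hlim
  exact ge_of_tendsto hlim h

namespace SetEquippedGraph

variable {V : Type*} [Fintype V] [DecidableEq V] {𝒢 : SetEquippedGraph V} {x y : ℝ}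

/-- The spectral radius `ρ_N(x)` of the generating matrix of the truncated sets `S_v ∩ [0, N]`. -/
noncomputable def truncRho (𝒢 : SetEquippedGraph V) (N : ℕ) (x : ℝ) : ℝ≥0∞ :=
  matrixSpectralRadius (genMatrix 𝒢.toDigraph (fun v => 𝒢.S v ∩ Set.Iic N) x)

theorem rho_eq_iSup_truncRho (hx : 0 < x) : 𝒢.rho x = ⨆ N, 𝒢.truncRho N x := by
  unfold rho
  split_ifs with h
  · apply le_antisymm
    · refine le_of_tendsto_one_of_le_ofReal_mul (l := 𝓝[>] 1)
        (tendsto_id.mono_left nhdsWithin_le_nhds) ?_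
      filter_upwards [self_mem_nhdsWithin] with c (hc : 1 < c)
      have hc0 := one_pos.trans hc
      have htrunc (v : V) :
          ∀ᶠ N in atTop, genFun (𝒢.S v) x / c < genFun (𝒢.S v ∩ Set.Iic N) x :=
        (tendsto_genFun_inter_Iic (h v)).eventually_const_lt
          (div_lt_self (genFun_pos (𝒢.S_nonempty v) hx (h v)) hc)
      obtain ⟨N, hN⟩ := (eventually_all.2 htrunc).exists
      calc matrixSpectralRadius (genMatrix 𝒢.toDigraph 𝒢.S x)
          ≤ ENNReal.ofReal c * 𝒢.truncRho N x :=
            matrixSpectralRadius_le_mul hc0 (genMatrix_nonneg _ _ hx.le)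
              (genMatrix_le_mul fun v => ((div_lt_iff₀' hc0).1 (hN v)).le)
        _ ≤ ENNReal.ofReal c * ⨆ N, 𝒢.truncRho N x := by
          gcongr
          exact le_iSup (fun N => 𝒢.truncRho N x) N
    · refine iSup_le fun N => ?_
      have hgen (v : V) : genFun (𝒢.S v ∩ Set.Iic N) x ≤ 1 * genFun (𝒢.S v) x := by
        rw [one_mul]
        exact genFun_mono_set hx.le Set.inter_subset_left (h v)
      simpa [truncRho] using matrixSpectralRadius_le_mul one_pos
        (genMatrix_nonneg 𝒢.toDigraph _ hx.le) (genMatrix_le_mul hgen)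
  · rfl

theorem truncRho_le_rho (hx : 0 < x) (N : ℕ) : 𝒢.truncRho N x ≤ 𝒢.rho x := by
  rw [rho_eq_iSup_truncRho hx]
  exact le_iSup (fun N => 𝒢.truncRho N x) N

theorem rho_le_div_mul (hx : 0 < x) (hxy : x ≤ y) :
    𝒢.rho x ≤ ENNReal.ofReal (x / y) * 𝒢.rho y := by
  have hy := hx.trans_le hxy
  rw [rho_eq_iSup_truncRho hx]
  refine iSup_le fun N => ?_
  calc 𝒢.truncRho N x ≤ ENNReal.ofReal (x / y) * 𝒢.truncRho N y :=
        matrixSpectralRadius_le_mul (div_pos hx hy) (genMatrix_nonneg _ _ hx.le)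
          (genMatrix_le_mul fun v => genFun_le_div_mul (fun s hs => 𝒢.S_pos v s hs.1) hx.le hxy hy
            (summable_pow_inter_Iic _ N y))
    _ ≤ _ := by gcongr; exact truncRho_le_rho hy N

theorem eq_of_rho_eq_one (hx : 0 < x) (hy : 0 < y) (hρx : 𝒢.rho x = 1) (hρy : 𝒢.rho y = 1) :
    x = y := by
  wlog hxy : x ≤ y generalizing x y
  · exact (this hy hx hρy hρx (le_of_not_ge hxy)).symm
  have hle := rho_le_div_mul (𝒢 := 𝒢) hx hxy
  rw [hρx, hρy, mul_one, ENNReal.one_le_ofReal, one_le_div hy] at hle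
  exact hxy.antisymm hle

theorem truncRho_le_pow_mul (N : ℕ) (hx : 0 < x) (hxy : x ≤ y) :
    𝒢.truncRho N y ≤ ENNReal.ofReal ((y / x) ^ N) * 𝒢.truncRho N x :=
  have hy := hx.trans_le hxy
  matrixSpectralRadius_le_mul (by positivity) (genMatrix_nonneg _ _ hy.le)
    (genMatrix_le_mul fun _ => genFun_inter_Iic_le_pow_mul hx hxy)

theorem truncRho_le_of_forall_lt {N : ℕ} {a : ℝ≥0∞} (hx : 0 < x)
    (h : ∀ y, 0 < y → y < x → 𝒢.truncRho N y ≤ a) : 𝒢.truncRho N x ≤ a := by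
  have hlim : Tendsto (fun y => (x / y) ^ N) (𝓝[<] x) (𝓝 1) := by
    have hcont : ContinuousAt (fun y => (x / y) ^ N) x := by fun_prop (disch := exact hx.ne')
    simpa [hx.ne'] using hcont.tendsto.mono_left nhdsWithin_le_nhds
  refine le_of_tendsto_one_of_le_ofReal_mul hlim ?_
  filter_upwards [Ioo_mem_nhdsLT hx] with y hy
  exact (truncRho_le_pow_mul N hy.1 hy.2.le).trans (by gcongr; exact h y hy.1 hy.2)

theorem one_le_rho_one (hB : 𝒢.blockWords.Nonempty) : 1 ≤ 𝒢.rho 1 := by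
  obtain ⟨-, u, -, -, -, hu, -⟩ := hB
  choose s hs using 𝒢.S_nonempty
  obtain ⟨N, hN⟩ := (Set.finite_range s).bddAbove
  have hedge (k : ℕ) :
      1 ≤ genMatrix 𝒢.toDigraph (fun v => 𝒢.S v ∩ Set.Iic N) 1 (u k) (u (k + 1 : ℕ)) := by
    rw [genMatrix, Matrix.of_apply, if_pos (by exact_mod_cast hu k)]
    simpa using pow_le_genFun (Set.mem_inter (hs (u k)) (hN ⟨u k, rfl⟩)) zero_le_one
      (summable_pow_inter_Iic _ N 1)
  exact (one_le_matrixSpectralRadius_of_walk (genMatrix_nonneg _ _ zero_le_one) hedge).trans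
    (truncRho_le_rho one_pos N)

variable [TopologicalSpace V] [DiscreteTopology V]

theorem truncRho_le_one (hx : 0 ≤ x)
    (hsum : ∑' w : language 𝒢.shiftSpace, ENNReal.ofReal x ^ (w : List V).length ≠ ∞) (N : ℕ) :
    𝒢.truncRho N x ≤ 1 := by
  have hM := genMatrix_nonneg 𝒢.toDigraph (fun v => 𝒢.S v ∩ Set.Iic N) hx
  refine matrixSpectralRadius_le_one_of_pow_apply_le hM (fun _ _ => adj_of_genMatrix_ne_zero)
    fun k i j hi hj => (ENNReal.ofReal_le_iff_le_toReal hsum).1 ?_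
  rw [ofReal_pow_apply hM, map_ofReal_genMatrix hx fun v => summable_pow_inter_Iic _ N x]
  exact (pow_apply_le_pow_apply (fun _ _ => zero_le)
    (extGenMatrix_mono (fun _ => Set.inter_subset_left) _) k i j).trans
    (extGenMatrix_pow_apply_le_tsum_language _ k hi hj)

theorem one_le_rho_of_tsum_language_eq_top (hx : 0 ≤ x) (hx1 : x < 1)
    (hsum : ∑' w : language 𝒢.shiftSpace, ENNReal.ofReal x ^ (w : List V).length = ∞) :
    1 ≤ 𝒢.rho x := by
  have hS (v : V) := summable_pow_subtype_of_lt_one (𝒢.S v) hx hx1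
  rw [rho, if_pos hS]
  by_contra! hlt
  refine (tsum_language_le (𝒢 := 𝒢) (ENNReal.ofReal x)).not_gt (hsum ▸ ?_)
  simp only [← map_ofReal_genMatrix hx hS, ← ofReal_pow_apply (genMatrix_nonneg _ _ hx)]
  have hgeom : (1 - ENNReal.ofReal x)⁻¹ ≠ ∞ :=
    ENNReal.inv_ne_top.2 (tsub_pos_of_lt (ENNReal.ofReal_lt_one.2 hx1)).ne'
  exact (ENNReal.mul_ne_top
    (ENNReal.pow_ne_top (ENNReal.mul_ne_top (ENNReal.natCast_ne_top _) hgeom))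
    (ENNReal.sum_ne_top.2 fun i _ => ENNReal.sum_ne_top.2 fun j _ =>
      tsum_ofReal_pow_apply_ne_top hlt i j)).lt_top

theorem rho_exp_neg_entropy {h : ℝ} (hB : 𝒢.blockWords.Nonempty) (h0 : 0 ≤ h)
    (hh : HasEntropy 𝒢.shiftSpace h)
    (hle : ∀ n : ℕ, Real.exp h ^ n ≤ ((allowedBlocks 𝒢.shiftSpace n).ncard : ℝ)) :
    𝒢.rho (Real.exp (-h)) = 1 := by
  apply le_antisymm
  · rw [rho_eq_iSup_truncRho (Real.exp_pos _)]
    exact iSup_le fun N => truncRho_le_of_forall_lt (Real.exp_pos _) fun y hy hyr =>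
      truncRho_le_one hy.le (tsum_language_ne_top hh hy hyr) N
  · rcases h0.eq_or_lt with rfl | h0
    · simpa using one_le_rho_one hB
    · exact one_le_rho_of_tsum_language_eq_top (Real.exp_nonneg _)
        (Real.exp_lt_one_iff.2 (neg_lt_zero.2 h0)) (tsum_language_exp_neg_eq_top hle)

end SetEquippedGraph

theorem theorem1p2 {V : Type*} [Fintype V] [DecidableEq V]
    [TopologicalSpace V] [DiscreteTopology V] (𝒢 : SetEquippedGraph V)
    (hX : 𝒢.shiftSpace.carrier.Nonempty) :
    ∃ l : ℝ, (0 < l ∧ 𝒢.rho l = 1) ∧ (∀ x : ℝ, 0 < x → 𝒢.rho x = 1 → x = l) ∧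
      HasEntropy 𝒢.shiftSpace (Real.log l⁻¹) := by
  obtain ⟨h, h0, hh, hle⟩ := exists_hasEntropy hX
  have hrho : 𝒢.rho (Real.exp (-h)) = 1 :=
    SetEquippedGraph.rho_exp_neg_entropy (closure_nonempty_iff.1 hX) h0 hh hle
  refine ⟨Real.exp (-h), ⟨Real.exp_pos _, hrho⟩, fun x hx hρx =>
    SetEquippedGraph.eq_of_rho_eq_one hx (Real.exp_pos _) hρx hrho, ?_⟩
  rwa [← Real.exp_neg, neg_neg, Real.log_exp]
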